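/- Let $\mathbb{F}_q$ be the finite field with $q$ elements and characteristic $p$; ideals are left ideals. Let $H$ be a finite non-abelian group with $p\nmid |H|$, let $H'$ be its commutator subgroup, $G:=H/H'$, and $\widehat{H'}:=\frac{1}{|H'|}\sum_{h\in H'}h\in\mathbb{F}_qH$. Let $w\in G$ have order $\exp(G)$, and put $t_w:=\min\{a\in\mathbb{Z}_{>0}: w^{q^a}=w\}$. A group code (left ideal) $C\subseteq \mathbb{F}_qH$ is called *ECD* if it is generated by an idempotent and $\dim_{\mathbb{F}_q}C\le p$. The algebra $\mathbb{F}_qH$ is called *minimal ECD* if it is semisimple and every left ideal generated by a primitive idempotent is ECD. The algebra $\mathbb{F}_qH$ has a Wedderburn decomposition, that is, an isomorphism of $\mathbb{F}_q$-algebras $$\mathbb{F}_qH\;\cong\;\bigoplus_{i=1}^{r}E_i\;\oplus\;\bigoplus_{j=1}^{s}M_{n_j}(F_j),$$ where all $E_i$ and $F_j$ are extension fields of $\mathbb{F}_q$ and all $n_j\ge 2$; and for every such decomposition $r,s\geq 1$. Moreover, for every such decomposition: 1. The largest dimension over $\mathbb{F}_q$ of a minimal ideal contained in $(\mathbb{F}_qH)\widehat{H'}$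 is $t_w$ (and it is attained). 2. Every minimal ideal contained in $(\mathbb{F}_qH)(1-\widehat{H'})$ has dimension $n_j\,[F_j:\mathbb{F}_q]$ for some $j\in\{1,\dots,s\}$. 3. $\mathbb{F}_qH$ is minimal ECD if and only if $t_w\le p$ and $\max\{n_j\,[F_j:\mathbb{F}_q]: 1\le j\le s\}\le p$. -/

import Mathlib

universe u v w

/-- A primitive idempotent of a ring: a nonzero idempotent that is not the sum of two nonzero
orthogonal idempotents. -/
def IsPrimitiveIdempotent {A : Type*} [Ring A] (e : A) : Prop :=
  IsIdempotentElem e ∧ e ≠ 0 ∧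
    ∀ f g : A, IsIdempotentElem f → IsIdempotentElem g → f * g = 0 → g * f = 0 →
      e = f + g → f = 0 ∨ g = 0

/-- An ECD (easily computable dimension) group code: a left ideal of the group algebra that is
generated by an idempotent and whose dimension is at most the characteristic of the field. -/
def IsECDCode (F H : Type*) [Field F] [Group H] (C : Ideal (MonoidAlgebra F H)) : Prop :=
  (∃ e : MonoidAlgebra F H, IsIdempotentElem e ∧ C = Ideal.span {e}) ∧
    Module.finrank F C ≤ ringChar F

/-- The group algebra is ECID: every principal indecomposable module, that is, every left ideal
generated by a primitive idempotent, is ECD. -/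
def IsECIDGroupAlgebra (F H : Type*) [Field F] [Group H] : Prop :=
  ∀ e : MonoidAlgebra F H, IsPrimitiveIdempotent e → IsECDCode F H (Ideal.span {e})

/-- The group algebra is minimal ECD: it is semisimple and ECID. -/
def IsMinimalECDGroupAlgebra (F H : Type*) [Field F] [Group H] : Prop :=
  IsSemisimpleRing (MonoidAlgebra F H) ∧ IsECIDGroupAlgebra F H

/-- The size `t_g` of the `q`-orbit of `g`: the least positive `a` with `g ^ (q ^ a) = g`.
Such an `a` exists when the order of `g` is finite and prime to `q`. -/
noncomputable def qOrbitSize {G : Type*} [Group G] (q : ℕ) (g : G) : ℕ :=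
  sInf {a : ℕ | 0 < a ∧ g ^ (q ^ a) = g}

/-- The element `(1 / |H'|) * ∑ h ∈ H', h` of the group algebra of a finite group `H`,
where `H'` is the commutator subgroup. -/
noncomputable def commutatorHat (F H : Type*) [Field F] [Group H] : MonoidAlgebra F H :=
  (Nat.card (commutator H) : F)⁻¹ • ∑ᶠ h : commutator H, MonoidAlgebra.of F H (h : H)

/-- A Wedderburn decomposition of an `F`-algebra `A` with components matrix algebras over fields:
`r` commutative components `E i` and `s` noncommutative ones, the full matrix
algebras `M_{n j}(K j)` with `n j ≥ 2`, where all `E i` and `K j` are extension fields of `F`. -/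
structure WedderburnDecomposition (F : Type u) (A : Type v) [Field F] [Ring A]
    [Algebra F A] where
  /-- the number of commutative components -/
  r : ℕ
  /-- the number of noncommutative components -/
  s : ℕ
  /-- the commutative components -/
  E : Fin r → Type w
  [fieldE : ∀ i, Field (E i)]
  [algebraE : ∀ i, Algebra F (E i)]
  /-- the sizes of the matrices in the noncommutative components -/
  n : Fin s → ℕ
  two_le_n : ∀ j, 2 ≤ n j
  /-- the fields of coefficients of the noncommutative components -/
  K : Fin s → Type w
  [fieldK : ∀ j, Field (K j)]
  [algebraK : ∀ j, Algebra F (K j)]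
  /-- the decomposition, as an isomorphism of `F`-algebras -/
  equiv : A ≃ₐ[F] ((∀ i, E i) × (∀ j, Matrix (Fin (n j)) (Fin (n j)) (K j)))

attribute [instance] WedderburnDecomposition.fieldE WedderburnDecomposition.algebraE
  WedderburnDecomposition.fieldK WedderburnDecomposition.algebraK

/-! ### Minimal left ideals and their dimensions -/

section AtomicLeftIdeals

variable {F A : Type*} [Field F] [Ring A] [Algebra F A] {I : Ideal A}

/-! Write `A` for the group algebra and `q` for the size of `F`. A minimal left ideal is `A x ≅ A /
ann x`, so its dimension is read off from any surjection with kernel `ann x`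
(`finrank_eq_of_isAtom`). An algebra map that does not vanish on a minimal ideal is injective on it.
For a matrix component this makes the ideal a column, of dimension `n * [K : F]`.

Every map to a commutative algebra sends `commutatorHat` to 1, so an ideal under `1 - commutatorHat`
must be seen by a matrix component. Under `commutatorHat` the action factors through the group
algebra of the abelianization, and `A / ann x` is a finite field in which `s ^ q ^ t = s`; this
bounds the dimension by `t`. A character of order the exponent gives an ideal attaining the bound.

By semisimplicity, ideals generated by primitive idempotents are exactly the minimal ones, and each
lies on one side of the central element `commutatorHat`; the ECD criterion follows. -/

theorem exists_mem_ne_zero_of_isAtom (hI : IsAtom I) : ∃ x ∈ I, x ≠ 0 :=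
  (Submodule.ne_bot_iff I).1 hI.1

theorem span_singleton_eq_of_isAtom (hI : IsAtom I) {x : A} (hx : x ∈ I) (hx0 : x ≠ 0) :
    Ideal.span {x} = I := by
  refine (hI.le_iff.1 ((Ideal.span_singleton_le_iff_mem _).2 hx)).resolve_left fun h => hx0 ?_
  exact Ideal.span_singleton_eq_bot.1 h

theorem finrank_eq_of_isAtom {W : Type*} [AddCommGroup W] [Module F W] (hI : IsAtom I)
    {x : A} (hx : x ∈ I) (hx0 : x ≠ 0) (g : A →ₗ[F] W) (hg : Function.Surjective g)
    (hker : ∀ a, g a = 0 ↔ a * x = 0) : Module.finrank F I = Module.finrank F W := by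
  let f : A →ₗ[F] I :=
    { toFun := fun a => ⟨a * x, I.mul_mem_left a hx⟩
      map_add' := fun a b => Subtype.ext (add_mul a b x)
      map_smul' := fun c a => Subtype.ext (smul_mul_assoc c a x) }
  have hf : Function.Surjective f := fun y => by
    have hy : (y : A) ∈ Ideal.span {x} := by
      rw [span_singleton_eq_of_isAtom hI hx hx0]; exact y.2
    obtain ⟨a, ha⟩ := Ideal.mem_span_singleton'.1 hy
    exact ⟨a, Subtype.ext ha⟩
  have hk : LinearMap.ker f = LinearMap.ker g := by
    ext a
    rw [LinearMap.mem_ker, LinearMap.mem_ker, hker, ← Subtype.coe_inj]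
    rfl
  exact ((f.quotKerEquivOfSurjective hf).symm.trans ((Submodule.quotEquivOfEq _ _ hk).trans
    (g.quotKerEquivOfSurjective hg))).finrank_eq

/-- A nonzero `y` would generate `I`, so the kernel of `f` would contain all of `I`. -/
theorem eq_zero_of_isAtom_of_map_eq_zero {B : Type*} [Ring B] (f : A →+* B) (hI : IsAtom I)
    {x : A} (hx : x ∈ I) (hfx : f x ≠ 0) {y : A} (hy : y ∈ I) (hfy : f y = 0) : y = 0 := by
  by_contra hy0
  have h : Ideal.span {y} = I := span_singleton_eq_of_isAtom hI hy hy0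
  rw [← h, Ideal.mem_span_singleton'] at hx
  obtain ⟨a, rfl⟩ := hx
  exact hfx (by rw [map_mul, hfy, mul_zero])

theorem finrank_eq_of_isAtom_of_matrix {n : ℕ} {K : Type*} [Field K] [Algebra F K]
    (f : A →ₐ[F] Matrix (Fin n) (Fin n) K) (hf : Function.Surjective f) (hI : IsAtom I)
    {x : A} (hx : x ∈ I) (hfx : f x ≠ 0) :
    Module.finrank F I = n * Module.finrank F K := by
  obtain ⟨a, b, hab⟩ : ∃ a b, f x a b ≠ 0 := by
    by_contra! h
    exact hfx (Matrix.ext h)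
  -- A lift of the matrix unit at `a` isolates row `a` of `f x`. The annihilator of `e * x` is then
  -- the kernel of taking column `a` of `f c`.
  obtain ⟨e, he⟩ := hf (Matrix.single a a 1)
  have hmul (c : A) (i k : Fin n) : f (c * (e * x)) i k = f c i a * f x a k := by
    rw [map_mul, map_mul, he, ← mul_assoc, Matrix.mul_apply, Finset.sum_eq_single a]
    · simp
    · intro j _ hj
      simp [Matrix.mul_single_apply_of_ne _ _ _ _ _ hj]
    · simp
  have hex : e * x ∈ I := I.mul_mem_left e hx
  have hfex : f (e * x) ≠ 0 := fun h => by
    have := hmul 1 a b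
    rw [one_mul, h] at this
    simp only [map_one, Matrix.one_apply_eq, one_mul, Matrix.zero_apply] at this
    exact hab this.symm
  let g : A →ₗ[F] (Fin n → K) :=
    { toFun := fun c i => f c i a
      map_add' := fun c d => by ext; simp
      map_smul' := fun r c => by ext; simp }
  have hg : Function.Surjective g := fun v => by
    obtain ⟨c, hc⟩ := hf (Matrix.of fun i _ => v i)
    exact ⟨c, by ext i; simp [g, hc]⟩
  rw [finrank_eq_of_isAtom hI hex (fun h => hfex (by rw [h, map_zero])) g hg,
    ← Module.finrank_mul_finrank F K (Fin n → K), Module.finrank_fin_fun, mul_comm]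
  intro c
  constructor
  · intro hc
    refine eq_zero_of_isAtom_of_map_eq_zero f.toRingHom hI hex hfex (I.mul_mem_left c hex) ?_
    ext i k
    have : f c i a = 0 := congrFun hc i
    simpa [this] using hmul c i k
  · intro hc
    ext i
    have := hmul c i b
    rw [hc, map_zero, Matrix.zero_apply] at this
    exact (mul_eq_zero.1 this.symm).resolve_right hab

/-- A complement of a smaller ideal `J` splits `e` as `f + g`; directness of the sum makes the parts
orthogonal idempotents, so one of them vanishes. -/
theorem isAtom_span_of_isPrimitiveIdempotent [IsSemisimpleRing A] {e : A}
    (he : IsPrimitiveIdempotent e) : IsAtom (Ideal.span {e}) := by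
  obtain ⟨hee, he0, hprim⟩ := he
  refine ⟨fun h => he0 (Ideal.span_singleton_eq_bot.1 h), fun J hJ => ?_⟩
  obtain ⟨J', hJ'⟩ := exists_isCompl J
  have hright {x : A} (hx : x ∈ Ideal.span {e}) : x * e = x := by
    obtain ⟨a, rfl⟩ := Ideal.mem_span_singleton'.1 hx
    rw [mul_assoc, hee.eq]
  have heJ : e ∈ J ⊔ J' := by rw [hJ'.sup_eq_top]; trivial
  obtain ⟨f, hf, g, hg, hfg⟩ := Submodule.mem_sup.1 heJ
  have hfe : f * e = f := hright (hJ.le hf)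
  have hge : g * e = g := by
    apply hright
    rw [eq_sub_of_add_eq' hfg]
    exact Ideal.sub_mem _ (Ideal.mem_span_singleton_self e) (hJ.le hf)
  have hdisj {x : A} (h : x ∈ J) (h' : x ∈ J') : x = 0 :=
    Submodule.disjoint_def.1 hJ'.disjoint x h h'
  have h1 : f * g = f - f * f := by
    rw [eq_sub_iff_add_eq', ← mul_add, hfg, hfe]
  have h2 : g * f = g - g * g := by
    rw [eq_sub_iff_add_eq, ← mul_add, hfg, hge]
  have hfg0 : f * g = 0 := hdisj (h1 ▸ J.sub_mem hf (J.mul_mem_left f hf)) (J'.mul_mem_left f hg)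
  have hgf0 : g * f = 0 := hdisj (J.mul_mem_left g hf) (h2 ▸ J'.sub_mem hg (J'.mul_mem_left g hg))
  rcases hprim f g (sub_eq_zero.1 (h1.symm.trans hfg0)).symm
    (sub_eq_zero.1 (h2.symm.trans hgf0)).symm hfg0 hgf0 hfg.symm with h | h
  · rw [h, zero_add] at hfg
    subst hfg
    rw [eq_bot_iff]
    exact fun x hx => hdisj hx ((Ideal.span_singleton_le_iff_mem _).2 hg (hJ.le hx))
  · rw [h, add_zero] at hfg
    subst hfg
    exact absurd ((Ideal.span_singleton_le_iff_mem _).2 hf) hJ.not_ge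

theorem exists_isPrimitiveIdempotent_of_isAtom [IsSemisimpleRing A] (hI : IsAtom I) :
    ∃ e : A, IsPrimitiveIdempotent e ∧ I = Ideal.span {e} := by
  obtain ⟨e, he, rfl⟩ := IsSemisimpleRing.ideal_eq_span_idempotent I
  have he0 : e ≠ 0 := fun h => hI.1 (Ideal.span_singleton_eq_bot.2 h)
  refine ⟨e, ⟨he, he0, fun f g hf hg hfg hgf hefg => ?_⟩, rfl⟩
  by_contra! h
  have hfe : f * e = f := by rw [hefg, mul_add, hf.eq, hfg, add_zero]
  have hfI : f ∈ Ideal.span {e} := Ideal.mem_span_singleton'.2 ⟨f, hfe⟩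
  have hef : e ∈ Ideal.span {f} := by
    rw [span_singleton_eq_of_isAtom hI hfI h.1]
    exact Ideal.mem_span_singleton_self e
  obtain ⟨a, ha⟩ := Ideal.mem_span_singleton'.1 hef
  apply h.2
  calc g = e * g := by rw [hefg, add_mul, hg.eq, hfg, zero_add]
    _ = 0 := by rw [← ha, mul_assoc, hfg, mul_zero]

/-- The minimal ideals generate `A`, so a map killing all of them would kill 1. -/
theorem exists_isAtom_map_ne_zero [IsSemisimpleRing A] {B : Type*} [Ring B] [Nontrivial B]
    (f : A →+* B) : ∃ I : Ideal A, IsAtom I ∧ ∃ x ∈ I, f x ≠ 0 := by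
  by_contra! h
  have htop : (⊤ : Ideal A) ≤ RingHom.ker f := by
    rw [← sSup_atoms_eq_top]
    exact sSup_le fun I hI x hx => (RingHom.mem_ker).2 (h I hI x hx)
  have : f 1 = 0 := (RingHom.mem_ker).1 (htop (Submodule.mem_top (x := (1 : A))))
  exact one_ne_zero ((map_one f).symm.trans this)

/-- Every minimal left ideal lies in one of the two summands given by a central idempotent. -/
theorem le_span_or_le_span_one_sub_of_isAtom {e : A} (he : ∀ a, e * a = a * e)
    (hI : IsAtom I) : I ≤ Ideal.span {e} ∨ I ≤ Ideal.span {1 - e} := by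
  by_cases h : ∃ x ∈ I, x * e ≠ 0
  · obtain ⟨x, hx, hxe⟩ := h
    left
    rw [← span_singleton_eq_of_isAtom hI (he x ▸ I.mul_mem_left e hx) hxe,
      Ideal.span_singleton_le_iff_mem]
    exact Ideal.mem_span_singleton'.2 ⟨x, rfl⟩
  · push Not at h
    right
    intro x hx
    exact Ideal.mem_span_singleton'.2 ⟨x, by rw [mul_sub, mul_one, h x hx, sub_zero]⟩

end AtomicLeftIdeals

/-! ### The averaging element of the commutator subgroup -/

section CommutatorHat

variable {F : Type*} [Field F] {H : Type*} [Group H]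

theorem of_mul_commutatorHat [Finite H] (c : commutator H) :
    MonoidAlgebra.of F H (c : H) * commutatorHat F H = commutatorHat F H := by
  classical
  have := Fintype.ofFinite (commutator H)
  rw [commutatorHat, mul_smul_comm, finsum_eq_sum_of_fintype, Finset.mul_sum]
  congr 1
  simp_rw [← map_mul]
  exact Fintype.sum_equiv (Equiv.mulLeft c) _ _ fun d => rfl

theorem of_mul_commutatorHat_comm [Finite H] (g : H) :
    MonoidAlgebra.of F H g * commutatorHat F H = commutatorHat F H * MonoidAlgebra.of F H g := by
  classical
  have := Fintype.ofFinite (commutator H)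
  rw [commutatorHat, mul_smul_comm, smul_mul_assoc, finsum_eq_sum_of_fintype, Finset.mul_sum,
    Finset.sum_mul]
  congr 1
  simp_rw [← map_mul]
  refine Fintype.sum_equiv (MulAut.conjNormal g).toEquiv _ _ fun d => ?_
  simp [MulAut.conjNormal_apply]

theorem commutatorHat_mul_comm [Finite H] (a : MonoidAlgebra F H) :
    commutatorHat F H * a = a * commutatorHat F H := by
  induction a using MonoidAlgebra.induction_on with
  | of g => exact (of_mul_commutatorHat_comm g).symm
  | add a b ha hb => rw [mul_add, add_mul, ha, hb]
  | smul r a ha => rw [mul_smul_comm, smul_mul_assoc, ha]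

theorem map_commutatorHat [Finite H] {B : Type*} [Ring B] [Algebra F B]
    (hF : (Nat.card (commutator H) : F) ≠ 0) (f : MonoidAlgebra F H →ₐ[F] B)
    (hf : ∀ c ∈ commutator H, f (MonoidAlgebra.of F H c) = 1) : f (commutatorHat F H) = 1 := by
  have := Fintype.ofFinite (commutator H)
  rw [commutatorHat, map_smul, finsum_eq_sum_of_fintype, map_sum,
    Finset.sum_congr rfl fun (c : commutator H) _ => hf c c.2, Finset.sum_const, Finset.card_univ,
    ← Nat.card_eq_fintype_card, ← Nat.cast_smul_eq_nsmul F, smul_smul, inv_mul_cancel₀ hF, one_smul]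

/-- The units of `B` form an abelian group, so commutators map to 1. -/
theorem map_commutatorHat_of_commRing [Finite H] {B : Type*} [CommRing B] [Algebra F B]
    (hF : (Nat.card (commutator H) : F) ≠ 0) (f : MonoidAlgebra F H →ₐ[F] B) :
    f (commutatorHat F H) = 1 := by
  refine map_commutatorHat hF f fun c hc => ?_
  let ψ : H →* Bˣ := ((f : MonoidAlgebra F H →* B).comp (MonoidAlgebra.of F H)).toHomUnits
  have : ψ c = 1 := MonoidHom.mem_ker.1 (Abelianization.commutator_subset_ker ψ hc)
  simpa [ψ] using congrArg Units.val this

variable (F H) in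
/-- The map of group algebras induced by the abelianization. -/
noncomputable def abelianizationAlgHom :
    MonoidAlgebra F H →ₐ[F] MonoidAlgebra F (Abelianization H) :=
  MonoidAlgebra.lift F _ H ((MonoidAlgebra.of F (Abelianization H)).comp Abelianization.of)

theorem abelianizationAlgHom_of (g : H) : abelianizationAlgHom F H (MonoidAlgebra.of F H g) =
    MonoidAlgebra.of F (Abelianization H) (Abelianization.of g) := by
  simp [abelianizationAlgHom]

theorem abelianizationAlgHom_surjective : Function.Surjective (abelianizationAlgHom F H) := by
  intro b
  induction b using MonoidAlgebra.induction_on with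
  | of g =>
    obtain ⟨h, rfl⟩ := QuotientGroup.mk_surjective g
    exact ⟨_, abelianizationAlgHom_of h⟩
  | add a b ha hb =>
    obtain ⟨a, rfl⟩ := ha
    obtain ⟨b, rfl⟩ := hb
    exact ⟨a + b, map_add _ a b⟩
  | smul r a ha =>
    obtain ⟨a, rfl⟩ := ha
    exact ⟨r • a, map_smul _ r a⟩

theorem mul_commutatorHat_eq_zero [Finite H] {a : MonoidAlgebra F H}
    (ha : abelianizationAlgHom F H a = 0) : a * commutatorHat F H = 0 := by
  -- Right multiplication by `commutatorHat` absorbs commutators, so it factors through the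
  -- abelianization; `ψ` is the factor, written with coset representatives.
  let ψ : MonoidAlgebra F (Abelianization H) →ₗ[F] MonoidAlgebra F H :=
    (Finsupp.linearCombination F fun g : Abelianization H =>
      MonoidAlgebra.of F H (Quotient.out g) * commutatorHat F H) ∘ₗ
      (MonoidAlgebra.coeffLinearEquiv F).toLinearMap
  have hψ (b : MonoidAlgebra F H) : ψ (abelianizationAlgHom F H b) = b * commutatorHat F H := by
    induction b using MonoidAlgebra.induction_on with
    | of g =>
      rw [abelianizationAlgHom_of]
      obtain ⟨c, hc⟩ := QuotientGroup.mk_out_eq_mul (commutator H) g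
      have h1 : ψ (MonoidAlgebra.of F _ (Abelianization.of g)) =
          MonoidAlgebra.of F H (Quotient.out (Abelianization.of g)) * commutatorHat F H := by
        simp [ψ]
      have h2 : Quotient.out (Abelianization.of g) = g * c := hc
      rw [h1, h2, map_mul, mul_assoc, of_mul_commutatorHat]
    | add a b ha hb => rw [map_add, map_add, ha, hb, add_mul]
    | smul r a ha => rw [map_smul, map_smul, ha, smul_mul_assoc]
  rw [← hψ, ha, map_zero]

end CommutatorHat

/-! ### Orbit sizes under the power map -/

section OrbitSize

/-- Euler's theorem makes the set nonempty, which excludes the default value `sInf ∅ = 0`. -/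
theorem qOrbitSize_spec {G : Type*} [Group G] [Finite G] {q : ℕ} {w : G}
    (hq : q.Coprime (orderOf w)) : 0 < qOrbitSize q w ∧ w ^ q ^ qOrbitSize q w = w := by
  refine Nat.sInf_mem (s := {a : ℕ | 0 < a ∧ w ^ q ^ a = w})
    ⟨(orderOf w).totient, Nat.totient_pos.2 (orderOf_pos w), ?_⟩
  conv_rhs => rw [← pow_one w]
  exact (pow_eq_pow_iff_modEq (x := w)).2 (Nat.ModEq.pow_totient hq)

theorem qOrbitSize_le {G : Type*} [Group G] {q a : ℕ} {w : G} (ha : 0 < a)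
    (h : w ^ q ^ a = w) : qOrbitSize q w ≤ a := Nat.sInf_le ⟨ha, h⟩

theorem pow_eq_self_iff_modEq {G : Type*} [Group G] {w : G} {n : ℕ} :
    w ^ n = w ↔ n ≡ 1 [MOD orderOf w] := by
  rw [← pow_eq_pow_iff_modEq, pow_one]

theorem MonoidAlgebra.pow_card_pow_eq_self {F G : Type*} [Field F] [Finite F] [CommGroup G]
    {t : ℕ} (ht : ∀ g : G, g ^ Nat.card F ^ t = g) (a : MonoidAlgebra F G) :
    a ^ Nat.card F ^ t = a := by
  have := Fintype.ofFinite F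
  -- The iterated Frobenius is `F`-linear, so it is determined by the group elements, which it
  -- fixes.
  have h : (FiniteField.frobeniusAlgHom F (MonoidAlgebra F G)) ^ t = AlgHom.id F _ := by
    refine MonoidAlgebra.algHom_ext (fun g => ?_) (Subsingleton.elim _ _)
    have : MonoidAlgebra.of F G g ^ Fintype.card F ^ t = MonoidAlgebra.of F G g := by
      rw [← map_pow (MonoidAlgebra.of F G), ← Nat.card_eq_fintype_card, ht]
    simpa [AlgHom.coe_pow, FiniteField.coe_frobeniusAlgHom, pow_iterate] using this
  have := DFunLike.congr_fun h a
  rwa [AlgHom.coe_pow, FiniteField.coe_frobeniusAlgHom, pow_iterate,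
    ← Nat.card_eq_fintype_card] at this

end OrbitSize

/-! ### Minimal ideals under the averaging element -/

section CommutativePart

variable {F : Type*} [Field F] {H : Type*} [Group H]

theorem natCard_le_of_pow_eq_self {S : Type*} [CommRing S] [IsDomain S] [Finite S] {n : ℕ}
    (hn : 1 < n) (h : ∀ s : S, s ^ n = s) : Nat.card S ≤ n := by
  classical
  have := Fintype.ofFinite S
  let := Fintype.fieldOfDomain S
  rw [Nat.card_eq_fintype_card, ← Finset.card_univ]
  refine (Polynomial.card_le_degree_of_subset_roots
    (p := (Polynomial.X ^ n - Polynomial.X : Polynomial S)) fun s _ => ?_).trans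
    (FiniteField.X_pow_card_sub_X_natDegree_eq S hn).le
  rw [Polynomial.mem_roots (FiniteField.X_pow_card_sub_X_ne_zero S hn)]
  simp [h]

theorem pow_natCard_eq_self {S : Type*} [CommRing S] [IsDomain S] [Finite S] (s : S) :
    s ^ Nat.card S = s := by
  classical
  have := Fintype.ofFinite S
  let := Fintype.fieldOfDomain S
  rw [Nat.card_eq_fintype_card]
  exact FiniteField.pow_card s

theorem finrank_le_of_isAtom_of_le_span_commutatorHat [Finite F] [Finite H]
    {t : ℕ} (ht0 : 0 < t)
    (ht : ∀ g : Abelianization H, g ^ Nat.card F ^ t = g)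
    {I : Ideal (MonoidAlgebra F H)} (hI : IsAtom I) (hle : I ≤ Ideal.span {commutatorHat F H}) :
    Module.finrank F I ≤ t := by
  have := Fintype.ofFinite F
  have : Module.Finite F (MonoidAlgebra F H) :=
    Module.Finite.equiv (MonoidAlgebra.coeffLinearEquiv F).symm
  obtain ⟨x, hx, hx0⟩ := exists_mem_ne_zero_of_isAtom hI
  set φ := abelianizationAlgHom F H
  have hφ : Function.Surjective φ := abelianizationAlgHom_surjective
  have hker {a : MonoidAlgebra F H} (ha : φ a = 0) : a * x = 0 := by
    obtain ⟨b, rfl⟩ := Ideal.mem_span_singleton'.1 (hle hx)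
    rw [← mul_assoc]
    exact mul_commutatorHat_eq_zero (by rw [map_mul, ha, zero_mul])
  have hcomm (a b : MonoidAlgebra F H) : a * b * x = b * a * x := by
    rw [← sub_eq_zero, ← sub_mul]
    exact hker (by rw [map_sub, map_mul, map_mul, mul_comm, sub_self])
  -- The image of `ann x`. It is prime because `b * x ≠ 0` again generates `I`, and the quotient is
  -- a finite domain of the same dimension as `I`.
  let M : Ideal (MonoidAlgebra F (Abelianization H)) :=
    Ideal.map φ.toRingHom (LinearMap.ker (LinearMap.toSpanSingleton (MonoidAlgebra F H) _ x))
  have hM (a : MonoidAlgebra F H) : φ a ∈ M ↔ a * x = 0 := by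
    refine (Ideal.mem_map_iff_of_surjective φ.toRingHom hφ).trans ⟨?_, fun h => ⟨a, h, rfl⟩⟩
    rintro ⟨b, hb, hab⟩
    have hb' : b * x = 0 := hb
    have h := hker (a := b - a) (by rw [map_sub, sub_eq_zero]; exact hab)
    rwa [sub_mul, hb', zero_sub, neg_eq_zero] at h
  have hMprime : M.IsPrime := by
    refine Ideal.isPrime_iff.2 ⟨fun h => hx0 ?_, fun {r s} hrs => ?_⟩
    · have h1 : φ 1 ∈ M := by rw [h]; trivial
      simpa using (hM 1).1 h1
    · obtain ⟨a, rfl⟩ := hφ r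
      obtain ⟨b, rfl⟩ := hφ s
      rw [← map_mul, hM] at hrs
      rw [hM, hM, or_iff_not_imp_right]
      intro hb
      have hxb : x ∈ Ideal.span {b * x} := by
        rwa [span_singleton_eq_of_isAtom hI (I.mul_mem_left b hx) hb]
      obtain ⟨c, hc⟩ := Ideal.mem_span_singleton'.1 hxb
      calc a * x = a * c * b * x := by rw [mul_assoc (a * c), mul_assoc a, hc]
        _ = a * (c * b * x) := by simp only [mul_assoc]
        _ = a * (b * c * x) := by rw [hcomm c b]
        _ = (a * b) * c * x := by simp only [mul_assoc]
        _ = c * (a * b) * x := hcomm _ _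
        _ = 0 := by rw [mul_assoc, hrs, mul_zero]
  let g : MonoidAlgebra F H →ₐ[F] (MonoidAlgebra F (Abelianization H) ⧸ M) :=
    (Ideal.Quotient.mkₐ F M).comp φ
  have hg : Function.Surjective g := (Ideal.Quotient.mkₐ_surjective F M).comp hφ
  have : Module.Finite F (MonoidAlgebra F (Abelianization H) ⧸ M) :=
    Module.Finite.of_surjective g.toLinearMap hg
  have : Finite (MonoidAlgebra F (Abelianization H) ⧸ M) := Module.finite_of_finite F
  rw [finrank_eq_of_isAtom hI hx hx0 g.toLinearMap hg
    fun a => Ideal.Quotient.eq_zero_iff_mem.trans (hM a)]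
  have hq : 1 < Nat.card F := Finite.one_lt_card
  refine (Nat.pow_le_pow_iff_right hq).1 ?_
  rw [← Module.natCard_eq_pow_finrank]
  refine natCard_le_of_pow_eq_self (Nat.one_lt_pow ht0.ne' hq) fun s => ?_
  obtain ⟨r, rfl⟩ := Ideal.Quotient.mk_surjective s
  rw [← map_pow, MonoidAlgebra.pow_card_pow_eq_self ht]

theorem exists_monoidHom_orderOf_eq_exponent (G : Type*) [CommGroup G] [Finite G]
    (K : Type*) [Field K] [HasEnoughRootsOfUnity K (Monoid.exponent G)] :
    ∃ χ : G →* Kˣ, orderOf χ = Monoid.exponent G := by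
  obtain ⟨e⟩ := CommGroup.monoidHom_mulEquiv_of_hasEnoughRootsOfUnity G K
  obtain ⟨g, hg⟩ := Monoid.exists_orderOf_eq_exponent
    (Monoid.ExponentExists.of_finite (G := G))
  exact ⟨e.symm g, by rw [MulEquiv.orderOf_eq, hg]⟩

theorem exists_isAtom_of_exponent_dvd [Finite F] [Finite H] [IsSemisimpleRing (MonoidAlgebra F H)]
    (hF : (Nat.card (commutator H) : F) ≠ 0)
    (hexp : (Monoid.exponent (Abelianization H) : F) ≠ 0) :
    ∃ I : Ideal (MonoidAlgebra F H), IsAtom I ∧ I ≤ Ideal.span {commutatorHat F H} ∧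
      0 < Module.finrank F I ∧
      Nat.card F ^ Module.finrank F I ≡ 1 [MOD Monoid.exponent (Abelianization H)] := by
  have := Fintype.ofFinite F
  have : Module.Finite F (MonoidAlgebra F H) :=
    Module.Finite.equiv (MonoidAlgebra.coeffLinearEquiv F).symm
  have : NeZero (Monoid.exponent (Abelianization H) : F) := ⟨hexp⟩
  obtain ⟨χ, hχ⟩ := exists_monoidHom_orderOf_eq_exponent (Abelianization H) (AlgebraicClosure F)
  let f : MonoidAlgebra F H →ₐ[F] AlgebraicClosure F :=
    MonoidAlgebra.lift F _ H ((Units.coeHom _).comp (χ.comp Abelianization.of))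
  have hf (h : H) : f (MonoidAlgebra.of F H h) = χ (Abelianization.of h) := by simp [f]
  obtain ⟨I, hI, x, hx, hfx⟩ := exists_isAtom_map_ne_zero f.toRingHom
  have hfx' : f x ≠ 0 := hfx
  have hx0 : x ≠ 0 := fun h => hfx' (by rw [h, map_zero])
  have hle : I ≤ Ideal.span {commutatorHat F H} := by
    refine (le_span_or_le_span_one_sub_of_isAtom commutatorHat_mul_comm hI).resolve_right
      fun h => hfx' ?_
    obtain ⟨a, rfl⟩ := Ideal.mem_span_singleton'.1 (h hx)
    rw [map_mul, map_sub, map_one, map_commutatorHat_of_commRing hF, sub_self, mul_zero]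
  have : Module.Finite F f.range := Module.Finite.of_surjective f.rangeRestrict.toLinearMap
    f.rangeRestrict_surjective
  have : Finite f.range := Module.finite_of_finite F
  have hdim : Module.finrank F I = Module.finrank F f.range := by
    refine finrank_eq_of_isAtom hI hx hx0 f.rangeRestrict.toLinearMap
      f.rangeRestrict_surjective fun a => ?_
    have h1 : f.rangeRestrict a = 0 ↔ f a = 0 := by
      rw [← Subtype.coe_inj]
      rfl
    refine h1.trans ⟨fun ha => ?_, fun ha => ?_⟩
    · refine eq_zero_of_isAtom_of_map_eq_zero f.toRingHom hI hx hfx (I.mul_mem_left a hx) ?_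
      change f (a * x) = 0
      rw [map_mul, ha, zero_mul]
    · have := congrArg f ha
      rw [map_mul, map_zero] at this
      exact (mul_eq_zero.1 this).resolve_right hfx'
  have hpow (s : f.range) : s ^ Nat.card F ^ Module.finrank F I = s := by
    rw [hdim, ← Module.natCard_eq_pow_finrank]
    exact pow_natCard_eq_self s
  refine ⟨I, hI, hle, ?_, ?_⟩
  · rw [hdim]
    exact Module.finrank_pos
  -- The values of `χ` lie in the finite domain `f.range` of size `q ^ finrank`, so that power fixes
  -- `χ`, whose order is the exponent.
  · rw [← hχ, ← pow_eq_self_iff_modEq]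
    ext h
    have := congrArg Subtype.val (hpow (f.rangeRestrict (MonoidAlgebra.of F H h)))
    have h2 : f (MonoidAlgebra.of F H h) ^ Nat.card F ^ Module.finrank F I
      = f (MonoidAlgebra.of F H h) := this
    rw [hf] at h2
    simpa using h2

end CommutativePart

/-! ### Existence of the decomposition -/

section Existence

theorem nonempty_matrix_algEquiv_of_eq_one (F K : Type*) [Field F] [Field K] [Algebra F K] {n : ℕ}
    (hn : n = 1) : Nonempty (Matrix (Fin n) (Fin n) K ≃ₐ[F] K) := by
  subst hn
  exact ⟨by convert Matrix.uniqueAlgEquiv (m := Fin 1) (A := K) (R := F)⟩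

/-- Split the index set of a product of matrix algebras according to the size of the matrices. -/
theorem nonempty_wedderburnDecomposition_of_pi {F : Type u} {A : Type v} [Field F] [Ring A]
    [Algebra F A] {m : ℕ} (K : Fin m → Type w) (d : Fin m → ℕ) [∀ i, Field (K i)]
    [∀ i, Algebra F (K i)] (hd : ∀ i, d i ≠ 0)
    (e : A ≃ₐ[F] ∀ i, Matrix (Fin (d i)) (Fin (d i)) (K i)) :
    Nonempty (WedderburnDecomposition.{u, v, w} F A) := by
  classical
  let α := (Fintype.equivFin {i // d i = 1}).symm
  let β := (Fintype.equivFin {i // ¬ d i = 1}).symm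
  let B (i : Fin m) := Matrix (Fin (d i)) (Fin (d i)) (K i)
  let split : (∀ i, B i) ≃ₐ[F] (∀ i : {i // d i = 1}, B i) × (∀ i : {i // ¬ d i = 1}, B i) :=
    AlgEquiv.ofRingEquiv (f := RingEquiv.piEquivPiSubtypeProd (fun i => d i = 1) B) fun _ => rfl
  let e₁ : (∀ i : {i // d i = 1}, B i) ≃ₐ[F] ∀ i, K (α i) :=
    (AlgEquiv.piCongrRight fun i : {i // d i = 1} =>
      (nonempty_matrix_algEquiv_of_eq_one F (K i) i.2).some).trans
      (AlgEquiv.piCongrLeft F (fun i : {i // d i = 1} => K i) α).symm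
  let e₂ : (∀ i : {i // ¬ d i = 1}, B i) ≃ₐ[F] ∀ i, B (β i) :=
    (AlgEquiv.piCongrLeft F (fun i : {i // ¬ d i = 1} => B i) β).symm
  exact ⟨{
    r := _
    s := _
    E := fun i => K (α i)
    n := fun j => d (β j)
    two_le_n := fun j => by have := hd (β j); have := (β j).2; omega
    K := fun j => K (β j)
    equiv := (e.trans split).trans (AlgEquiv.prodCongr e₁ e₂) }⟩

theorem nonempty_wedderburnDecomposition {F : Type u} {A : Type v} [Field F] [Finite F] [Ring A]
    [Algebra F A] [Module.Finite F A] [IsSemisimpleRing A] :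
    Nonempty (WedderburnDecomposition.{u, v, v} F A) := by
  obtain ⟨m, D, d, _, _, _, hd, ⟨e⟩⟩ :=
    IsSemisimpleRing.exists_algEquiv_pi_matrix_divisionRing_finite F A
  -- Finite division rings are fields, by Wedderburn's little theorem.
  have (i : Fin m) : Finite (D i) := Module.finite_of_finite F
  exact nonempty_wedderburnDecomposition_of_pi D d (fun i => (hd i).out) e

end Existence

/-! ### Reading dimensions off a decomposition -/

section Decomposition

namespace WedderburnDecomposition

variable {F : Type u} {A : Type v} [Field F] [Ring A] [Algebra F A]
  (D : WedderburnDecomposition.{u, v, w} F A)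

/-- The projection to a commutative component. -/
def projE (i : Fin D.r) : A →ₐ[F] D.E i :=
  ((Pi.evalAlgHom F D.E i).comp (AlgHom.fst F _ _)).comp D.equiv.toAlgHom

/-- The projection to a noncommutative component. -/
def projMatrix (j : Fin D.s) : A →ₐ[F] Matrix (Fin (D.n j)) (Fin (D.n j)) (D.K j) :=
  ((Pi.evalAlgHom F (fun j => Matrix (Fin (D.n j)) (Fin (D.n j)) (D.K j)) j).comp
    (AlgHom.snd F _ _)).comp D.equiv.toAlgHom

theorem projMatrix_surjective (j : Fin D.s) : Function.Surjective (D.projMatrix j) :=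
  (Function.surjective_eval j).comp (Prod.snd_surjective.comp D.equiv.surjective)

theorem eq_zero_of_proj_eq_zero {x : A} (h : ∀ i, D.projE i x = 0)
    (h' : ∀ j, D.projMatrix j x = 0) : x = 0 := by
  rw [← map_eq_zero_iff D.equiv D.equiv.injective]
  exact Prod.ext (funext h) (funext h')

theorem s_pos_of_not_commute (h : ∃ a b : A, a * b ≠ b * a) : 0 < D.s := by
  by_contra! hs
  obtain ⟨a, b, hab⟩ := h
  refine hab (sub_eq_zero.1 (D.eq_zero_of_proj_eq_zero (fun i => ?_) fun j => ?_))
  · rw [map_sub, map_mul, map_mul, mul_comm, sub_self]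
  · exact absurd j.2 (by omega)

theorem finrank_eq_of_projMatrix_ne_zero {I : Ideal A} (hI : IsAtom I) {x : A} (hx : x ∈ I)
    {j : Fin D.s} (hj : D.projMatrix j x ≠ 0) :
    Module.finrank F I = D.n j * Module.finrank F (D.K j) :=
  finrank_eq_of_isAtom_of_matrix (D.projMatrix j) (D.projMatrix_surjective j) hI hx hj

theorem exists_isAtom_finrank_eq [IsSemisimpleRing A] (j : Fin D.s) :
    ∃ I : Ideal A, IsAtom I ∧ Module.finrank F I = D.n j * Module.finrank F (D.K j) := by
  have : Nonempty (Fin (D.n j)) := ⟨⟨0, (Nat.zero_lt_two.trans_le (D.two_le_n j))⟩⟩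
  obtain ⟨I, hI, x, hx, hfx⟩ := exists_isAtom_map_ne_zero (D.projMatrix j).toRingHom
  exact ⟨I, hI, D.finrank_eq_of_projMatrix_ne_zero hI hx hfx⟩

/-- A minimal ideal on which `ε` is nonzero has dimension 1, while matrix components only give
dimensions divisible by some `n j ≥ 2`. -/
theorem r_pos_of_algHom [IsSemisimpleRing A] (ε : A →ₐ[F] F) : 0 < D.r := by
  by_contra! hr
  obtain ⟨I, hI, x, hx, hfx⟩ := exists_isAtom_map_ne_zero ε.toRingHom
  have hεx : ε x ≠ 0 := hfx
  have hx0 : x ≠ 0 := fun h => hεx (by rw [h, map_zero])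
  have hε : Function.Surjective ε := fun c => ⟨algebraMap F A c, ε.commutes c⟩
  obtain ⟨j, hj⟩ : ∃ j, D.projMatrix j x ≠ 0 := by
    by_contra! h
    exact hx0 (D.eq_zero_of_proj_eq_zero (fun i => absurd i.2 (by omega)) h)
  have h1 : Module.finrank F I = 1 := by
    rw [finrank_eq_of_isAtom hI hx hx0 ε.toLinearMap hε fun a => ?_, Module.finrank_self]
    refine ⟨fun ha => ?_, fun ha => ?_⟩
    · refine eq_zero_of_isAtom_of_map_eq_zero ε.toRingHom hI hx hfx (I.mul_mem_left a hx) ?_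
      have ha' : ε a = 0 := ha
      change ε (a * x) = 0
      rw [map_mul, ha', zero_mul]
    · have := congrArg ε ha
      rw [map_mul, map_zero] at this
      exact (mul_eq_zero.1 this).resolve_right hεx
  have h2 := D.finrank_eq_of_projMatrix_ne_zero hI hx hj
  rw [h1] at h2
  have := Nat.eq_one_of_mul_eq_one_right h2.symm
  have := D.two_le_n j
  omega

end WedderburnDecomposition

theorem exists_finrank_eq_of_le_span_one_sub_commutatorHat {F : Type u} {H : Type v} [Field F]
    [Group H] [Finite H] (hF : (Nat.card (commutator H) : F) ≠ 0)
    (D : WedderburnDecomposition.{u, max u v, w} F (MonoidAlgebra F H))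
    {I : Ideal (MonoidAlgebra F H)} (hI : IsAtom I) (hle : I ≤ Ideal.span {1 - commutatorHat F H}) :
    ∃ j, Module.finrank F I = D.n j * Module.finrank F (D.K j) := by
  obtain ⟨x, hx, hx0⟩ := exists_mem_ne_zero_of_isAtom hI
  obtain ⟨j, hj⟩ : ∃ j, D.projMatrix j x ≠ 0 := by
    by_contra! h
    refine hx0 (D.eq_zero_of_proj_eq_zero (fun i => ?_) h)
    obtain ⟨a, rfl⟩ := Ideal.mem_span_singleton'.1 (hle hx)
    rw [map_mul, map_sub, map_one, map_commutatorHat_of_commRing hF, sub_self, mul_zero]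
  exact ⟨j, D.finrank_eq_of_projMatrix_ne_zero hI hx hj⟩

theorem isECIDGroupAlgebra_iff_forall_isAtom {F H : Type*} [Field F] [Group H]
    [IsSemisimpleRing (MonoidAlgebra F H)] :
    IsECIDGroupAlgebra F H ↔
      ∀ I : Ideal (MonoidAlgebra F H), IsAtom I → Module.finrank F I ≤ ringChar F := by
  refine ⟨fun h I hI => ?_, fun h e he => ⟨⟨e, he.1, rfl⟩, ?_⟩⟩
  · obtain ⟨e, he, rfl⟩ := exists_isPrimitiveIdempotent_of_isAtom hI
    exact (h e he).2
  · exact h _ (isAtom_span_of_isPrimitiveIdempotent he)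

end Decomposition

theorem theorem4p3 (F : Type u) [Field F] [Finite F] (p : ℕ) [CharP F p]
    (H : Type v) [Group H] [Finite H] (hH : ¬ ∀ a b : H, a * b = b * a)
    (hp : ¬ p ∣ Nat.card H)
    (w : Abelianization H) (hx : orderOf w = Monoid.exponent (Abelianization H)) :
    -- the largest dimension of a minimal left ideal in the commutative part is `t_w`
    IsGreatest {d : ℕ | ∃ I : Ideal (MonoidAlgebra F H), IsAtom I ∧
        I ≤ Ideal.span {commutatorHat F H} ∧ Module.finrank F I = d}
      (qOrbitSize (Nat.card F) w) ∧
    -- a Wedderburn decomposition of the group algebra exists, and for every one of them: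
    Nonempty (WedderburnDecomposition.{u, max u v, max u v} F (MonoidAlgebra F H)) ∧
    ∀ D : WedderburnDecomposition.{u, max u v, w} F (MonoidAlgebra F H),
      0 < D.r ∧ 0 < D.s ∧
      (∀ I : Ideal (MonoidAlgebra F H), IsAtom I → I ≤ Ideal.span {1 - commutatorHat F H} →
        ∃ j, Module.finrank F I = D.n j * Module.finrank F (D.K j)) ∧
      (IsMinimalECDGroupAlgebra F H ↔
        qOrbitSize (Nat.card F) w ≤ p ∧
          (Finset.univ.sup fun j => D.n j * Module.finrank F (D.K j)) ≤ p) := by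
  have hcast {k : ℕ} (hk : k ∣ Nat.card H) : (k : F) ≠ 0 := fun h =>
    hp (((CharP.cast_eq_zero_iff F p k).1 h).trans hk)
  have : NeZero (Nat.card H : F) := ⟨hcast dvd_rfl⟩
  have hss : IsSemisimpleRing (MonoidAlgebra F H) := inferInstance
  have : Module.Finite F (MonoidAlgebra F H) :=
    Module.Finite.equiv (MonoidAlgebra.coeffLinearEquiv F).symm
  have hF : (Nat.card (commutator H) : F) ≠ 0 := hcast (Subgroup.card_subgroup_dvd_card _)
  have hexpdvd : Monoid.exponent (Abelianization H) ∣ Nat.card H :=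
    Group.exponent_dvd_nat_card.trans (Subgroup.card_quotient_dvd_card _)
  have hcop : (Nat.card F).Coprime (orderOf w) := by
    have := Fintype.ofFinite F
    obtain ⟨k, hpp, hk⟩ := FiniteField.card F p
    rw [Nat.card_eq_fintype_card, hk, hx]
    exact Nat.Coprime.pow_left _ ((hpp.coprime_iff_not_dvd).2 fun h => hp (h.trans hexpdvd))
  obtain ⟨ht0, ht⟩ := qOrbitSize_spec hcop
  -- Every order divides the exponent, which is the order of `w`, so the exponent found for `w`
  -- serves all `g`.
  have htG (g : Abelianization H) : g ^ Nat.card F ^ qOrbitSize (Nat.card F) w = g :=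
    pow_eq_self_iff_modEq.2 ((pow_eq_self_iff_modEq.1 ht).of_dvd
      (hx ▸ Monoid.order_dvd_exponent g))
  have hgreatest : IsGreatest {d : ℕ | ∃ I : Ideal (MonoidAlgebra F H), IsAtom I ∧
        I ≤ Ideal.span {commutatorHat F H} ∧ Module.finrank F I = d}
      (qOrbitSize (Nat.card F) w) := by
    have hub {I : Ideal (MonoidAlgebra F H)} (hI : IsAtom I)
        (hle : I ≤ Ideal.span {commutatorHat F H}) :=
      finrank_le_of_isAtom_of_le_span_commutatorHat ht0 htG hI hle
    refine ⟨?_, fun d ⟨I, hI, hle, hd⟩ => hd ▸ hub hI hle⟩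
    obtain ⟨I, hI, hle, hpos, hmod⟩ := exists_isAtom_of_exponent_dvd hF (hcast hexpdvd)
    exact ⟨I, hI, hle, (hub hI hle).antisymm
      (qOrbitSize_le hpos (pow_eq_self_iff_modEq.2 (hx ▸ hmod)))⟩
  refine ⟨hgreatest, nonempty_wedderburnDecomposition, fun D => ⟨?_, ?_, fun I hI hle =>
    exists_finrank_eq_of_le_span_one_sub_commutatorHat hF D hI hle, ?_⟩⟩
  · exact D.r_pos_of_algHom (MonoidAlgebra.lift F F H 1)
  · refine D.s_pos_of_not_commute ?_
    push Not at hH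
    obtain ⟨a, b, hab⟩ := hH
    refine ⟨MonoidAlgebra.of F H a, MonoidAlgebra.of F H b, fun h => hab ?_⟩
    rw [← map_mul, ← map_mul] at h
    exact MonoidAlgebra.of_injective h
  · rw [IsMinimalECDGroupAlgebra, and_iff_right hss, isECIDGroupAlgebra_iff_forall_isAtom,
      ringChar.eq F p, Finset.sup_le_iff]
    constructor
    · intro h
      obtain ⟨I, hI, -, hd⟩ := hgreatest.1
      refine ⟨hd ▸ h I hI, fun j _ => ?_⟩
      obtain ⟨J, hJ, hd⟩ := D.exists_isAtom_finrank_eq j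
      exact hd ▸ h J hJ
    · rintro ⟨h1, h2⟩ I hI
      rcases le_span_or_le_span_one_sub_of_isAtom commutatorHat_mul_comm hI with hle | hle
      · exact (hgreatest.2 ⟨I, hI, hle, rfl⟩).trans h1
      · obtain ⟨j, hj⟩ := exists_finrank_eq_of_le_span_one_sub_commutatorHat hF D hI hle
        exact hj ▸ h2 j (Finset.mem_univ j)
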